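/- For $a,q\in\mathbb{C}$ and $n\in\mathbb{Z}_{\ge 0}$ write $(a;q)_n=\prod_{k=0}^{n-1}(1-aq^k)$ (so $(a;q)_0=1$) and, for $|q|<1$, $(a;q)_\infty=\prod_{k=0}^{\infty}(1-aq^k)$ and $(a_1,a_2,a_3;q)_\infty=(a_1;q)_\infty(a_2;q)_\infty(a_3;q)_\infty$. Then for every $q\in\mathbb{C}$ with $|q|<1$ the following series converges absolutely and $$\sum_{n=0}^{\infty}\frac{(q;q^2)_{2n}\,q^{2n^2}(-1)^n}{(q^8;q^8)_n\,(-q^2;q^4)_n} =(-q^3,-q^5,q^8;q^8)_\infty\,\frac{(q^2;q^4)_\infty}{(q^4;q^4)_\infty}.$$ -/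

import Mathlib

/-- The finite `q`-shifted factorial `(a; q)_n = (1 - a) (1 - a q) ⋯ (1 - a q ^ (n - 1))`. -/
noncomputable def qPoch (a q : ℂ) (n : ℕ) : ℂ :=
  ∏ k ∈ Finset.range n, (1 - a * q ^ k)

/-- The infinite `q`-shifted factorial `(a; q)_∞ = ∏_{k ≥ 0} (1 - a q ^ k)`, for `‖q‖ < 1`. -/
noncomputable def qPochInf (a q : ℂ) : ℂ :=
  ∏' k : ℕ, (1 - a * q ^ k)

/-- For `‖q‖ < 1` the infinite product defining `(a; q)_∞` converges. -/
theorem multipliable_qPochInf (a : ℂ) {q : ℂ} (hq : ‖q‖ < 1) :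
    Multipliable (fun k : ℕ => 1 - a * q ^ k) := by
  have h : Summable (fun k : ℕ => ‖-(a * q ^ k)‖) := by
    simpa [norm_mul, norm_pow] using
      (summable_geometric_of_lt_one (norm_nonneg q) hq).mul_left ‖a‖
  simpa [sub_eq_add_neg] using multipliable_one_add_of_summable h

/-- For `‖q‖ < 1`, `(a; q)_∞` is the limit of the finite factorials `(a; q)_n`. -/
theorem tendsto_qPoch (a : ℂ) {q : ℂ} (hq : ‖q‖ < 1) :
    Filter.Tendsto (qPoch a q) Filter.atTop (nhds (qPochInf a q)) :=
  (multipliable_qPochInf a hq).hasProd.tendsto_prod_nat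

/-!
The series is a case of Andrews' `q`-analogue of Bailey's theorem: for `a b = q`,

  `∑ (a; q)_n (b; q)_n q ^ (n choose 2) c ^ n / ((q²; q²)_n (c; q)_n)`
  `  = (a c; q²)_∞ (b c; q²)_∞ / (c; q)_∞`,

taken with base `q ^ 4`, `a = q ^ 3`, `b = q` and `c = -q ^ 2`.  The factorials of the series are
matched with `qPoch_two_mul` (splitting a product by the parity of the index), and the infinite
products with `(x; q)_∞ (-x; q)_∞ = (x²; q²)_∞`.

Bailey's theorem (`hasSum_baileyTerm`) follows from a functional equation in `c`.  With `S c` the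
sum of the series,

  `(1 - c) (1 - c q) S c = (1 - a c) (1 - b c) S (c q²)`   (`tsum_baileyTerm_functional`),

because the difference of the two sides telescopes term by term (`baileyTerm_telescope`).  Iterating
it gives `S c = (a c; q²)_m (b c; q²)_m / (c; q)_{2m} * S (c q ^ (2m))`, and `S (c q ^ (2m))` tends
to `1` by dominated convergence.
-/

open Filter Topology

/-! ### Finite and infinite `q`-shifted factorials -/

theorem qPoch_zero (a q : ℂ) : qPoch a q 0 = 1 := by
  simp [qPoch]

theorem qPoch_succ (a q : ℂ) (n : ℕ) :
    qPoch a q (n + 1) = qPoch a q n * (1 - a * q ^ n) :=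
  Finset.prod_range_succ _ _

theorem qPoch_add (a q : ℂ) (m n : ℕ) :
    qPoch a q (m + n) = qPoch a q m * qPoch (a * q ^ m) q n := by
  simp only [qPoch, Finset.prod_range_add, pow_add, mul_assoc]

theorem qPoch_two_mul (a q : ℂ) (n : ℕ) :
    qPoch a q (2 * n) = qPoch a (q ^ 2) n * qPoch (a * q) (q ^ 2) n := by
  induction n with
  | zero => simp [qPoch_zero]
  | succ n ih =>
    rw [show 2 * (n + 1) = 2 * n + 1 + 1 by ring]
    simp only [qPoch_succ, ih]
    ring

theorem qPoch_mul_qPoch_neg (a q : ℂ) (n : ℕ) :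
    qPoch a q n * qPoch (-a) q n = qPoch (a ^ 2) (q ^ 2) n := by
  simp only [qPoch, ← Finset.prod_mul_distrib]
  exact Finset.prod_congr rfl fun k _ => by ring

theorem norm_mul_pow_lt_one {q c : ℂ} (hq : ‖q‖ < 1) (hc : ‖c‖ < 1) (m : ℕ) :
    ‖c * q ^ m‖ < 1 := by
  rw [norm_mul, norm_pow]
  exact mul_lt_one_of_nonneg_of_lt_one_left (norm_nonneg _) hc
    (pow_le_one₀ (norm_nonneg _) hq.le)

theorem one_sub_mul_pow_ne_zero {a q : ℂ} (ha : ‖a‖ < 1) (hq : ‖q‖ < 1) (k : ℕ) :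
    1 - a * q ^ k ≠ 0 := by
  intro h
  have h1 := norm_mul_pow_lt_one hq ha k
  rw [← sub_eq_zero.mp h, norm_one] at h1
  exact lt_irrefl _ h1

theorem qPoch_ne_zero {a q : ℂ} (ha : ‖a‖ < 1) (hq : ‖q‖ < 1) (n : ℕ) : qPoch a q n ≠ 0 :=
  Finset.prod_ne_zero_iff.mpr fun k _ => one_sub_mul_pow_ne_zero ha hq k

theorem qPochInf_ne_zero {a q : ℂ} (ha : ‖a‖ < 1) (hq : ‖q‖ < 1) : qPochInf a q ≠ 0 := by
  have h : Summable (fun k : ℕ => ‖-(a * q ^ k)‖) := by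
    simpa [norm_mul, norm_pow] using
      (summable_geometric_of_lt_one (norm_nonneg q) hq).mul_left ‖a‖
  simpa [qPochInf, sub_eq_add_neg] using tprod_one_add_ne_zero_of_summable
    (fun k => by simpa [sub_eq_add_neg] using one_sub_mul_pow_ne_zero ha hq k) h

theorem norm_sq_lt_one {q : ℂ} (hq : ‖q‖ < 1) : ‖q ^ 2‖ < 1 := by
  rw [norm_pow]
  exact pow_lt_one₀ (norm_nonneg _) hq two_ne_zero

theorem qPochInf_eq_mul (a : ℂ) {q : ℂ} (hq : ‖q‖ < 1) :
    qPochInf a q = qPochInf a (q ^ 2) * qPochInf (a * q) (q ^ 2) := by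
  have h2 : Tendsto (fun n : ℕ => 2 * n) atTop atTop :=
    tendsto_id.const_mul_atTop' two_pos
  refine tendsto_nhds_unique ((tendsto_qPoch a hq).comp h2) ?_
  simpa only [Function.comp_def, qPoch_two_mul] using
    (tendsto_qPoch a (norm_sq_lt_one hq)).mul (tendsto_qPoch (a * q) (norm_sq_lt_one hq))

theorem qPochInf_mul_qPochInf_neg (a : ℂ) {q : ℂ} (hq : ‖q‖ < 1) :
    qPochInf a q * qPochInf (-a) q = qPochInf (a ^ 2) (q ^ 2) := by
  refine tendsto_nhds_unique ((tendsto_qPoch a hq).mul (tendsto_qPoch (-a) hq)) ?_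
  simpa only [qPoch_mul_qPoch_neg] using tendsto_qPoch (a ^ 2) (norm_sq_lt_one hq)

theorem exists_norm_le_of_tendsto {u : ℕ → ℂ} {x : ℂ} (hu : Tendsto u atTop (𝓝 x)) :
    ∃ K, ∀ n, ‖u n‖ ≤ K := by
  obtain ⟨K, hK⟩ := (Metric.isBounded_range_of_tendsto u hu).exists_norm_le
  exact ⟨K, fun n => hK _ ⟨n, rfl⟩⟩

/-! ### The terms of Bailey's series -/

/-- The coefficient `(a; q)_n (b; q)_n q ^ (n choose 2) / (q²; q²)_n` of Bailey's series. -/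
noncomputable def baileyCoeff (a b q : ℂ) (n : ℕ) : ℂ :=
  qPoch a q n * qPoch b q n * q ^ n.choose 2 / qPoch (q ^ 2) (q ^ 2) n

/-- The term `(a; q)_n (b; q)_n q ^ (n choose 2) c ^ n / ((q²; q²)_n (c; q)_n)` of Bailey's
series. -/
noncomputable def baileyTerm (a b q c : ℂ) (n : ℕ) : ℂ :=
  baileyCoeff a b q n * c ^ n / qPoch c q n

theorem baileyCoeff_succ {q : ℂ} (a b : ℂ) (hq : ‖q‖ < 1) (n : ℕ) :
    (1 - q ^ (2 * (n + 1))) * baileyCoeff a b q (n + 1) =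
      (1 - a * q ^ n) * (1 - b * q ^ n) * q ^ n * baileyCoeff a b q n := by
  have hq2 := norm_sq_lt_one hq
  have h1 := qPoch_ne_zero hq2 hq2 n
  have h2 := one_sub_mul_pow_ne_zero hq2 hq2 n
  have h3 : (n + 1).choose 2 = n + n.choose 2 := by
    rw [Nat.choose_succ_succ' n 1, Nat.choose_one_right]
  have h4 : 1 - q ^ (2 * (n + 1)) = 1 - q ^ 2 * (q ^ 2) ^ n := by ring
  simp only [baileyCoeff, qPoch_succ, h3, pow_add, h4]
  field_simp

theorem exists_norm_baileyCoeff_le {q : ℂ} (a b : ℂ) (hq : ‖q‖ < 1) :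
    ∃ K, ∀ n, ‖baileyCoeff a b q n‖ ≤ K := by
  have hq2 := norm_sq_lt_one hq
  obtain ⟨K, hK⟩ := exists_norm_le_of_tendsto
    (((tendsto_qPoch a hq).mul (tendsto_qPoch b hq)).div (tendsto_qPoch (q ^ 2) hq2)
      (qPochInf_ne_zero hq2 hq2))
  refine ⟨K, fun n => le_trans ?_ (hK n)⟩
  have h : baileyCoeff a b q n =
      qPoch a q n * qPoch b q n / qPoch (q ^ 2) (q ^ 2) n * q ^ n.choose 2 := by
    rw [baileyCoeff]; ring
  rw [h, norm_mul, norm_pow]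
  exact mul_le_of_le_one_right (norm_nonneg _) (pow_le_one₀ (norm_nonneg _) hq.le)

/-- A bound for the terms which is uniform over the shifts `c q ^ m` of `c`, since
`1 / (c q ^ m; q)_n = (c; q)_m / (c; q)_{m + n}`. -/
theorem exists_norm_baileyTerm_le {q c : ℂ} (a b : ℂ) (hq : ‖q‖ < 1) (hc : ‖c‖ < 1) :
    ∃ K, ∀ m n, ‖baileyTerm a b q (c * q ^ m) n‖ ≤ K * ‖c * q ^ m‖ ^ n := by
  obtain ⟨K₁, h₁⟩ := exists_norm_baileyCoeff_le a b hq
  obtain ⟨K₂, h₂⟩ := exists_norm_le_of_tendsto (tendsto_qPoch c hq)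
  obtain ⟨K₃, h₃⟩ := exists_norm_le_of_tendsto
    ((tendsto_qPoch c hq).inv₀ (qPochInf_ne_zero hc hq))
  refine ⟨K₁ * (K₂ * K₃), fun m n => ?_⟩
  have h : baileyTerm a b q (c * q ^ m) n =
      baileyCoeff a b q n * (qPoch c q m * (qPoch c q (m + n))⁻¹) * (c * q ^ m) ^ n := by
    have := qPoch_ne_zero hc hq m
    rw [baileyTerm, qPoch_add, mul_inv, mul_inv_cancel_left₀ this]
    ring
  rw [h, norm_mul, norm_mul, norm_mul, norm_pow]
  have hK₁ := (norm_nonneg _).trans (h₁ 0)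
  have hK₂ := (norm_nonneg _).trans (h₂ 0)
  gcongr
  exacts [h₁ n, h₂ m, h₃ (m + n)]

theorem summable_baileyTerm {q c : ℂ} (a b : ℂ) (hq : ‖q‖ < 1) (hc : ‖c‖ < 1) :
    Summable (baileyTerm a b q c) := by
  obtain ⟨K, hK⟩ := exists_norm_baileyTerm_le a b hq hc
  refine Summable.of_norm_bounded
    ((summable_geometric_of_lt_one (norm_nonneg c) hc).mul_left K) fun n => ?_
  simpa using hK 0 n

/-! ### The functional equation and Bailey's theorem -/

/-- With `G n = (1 - q ^ (2n)) / (1 - c q ^ n) * baileyTerm a b q c n`, the difference of the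
`n`-th terms of the two sides of the functional equation is
`(1 - c) (1 - c q) (G n - G (n + 1))`. -/
theorem baileyTerm_telescope {a b q c : ℂ} (hab : a * b = q) (hq : ‖q‖ < 1) (hc : ‖c‖ < 1)
    (n : ℕ) :
    (1 - c) * (1 - c * q) * baileyTerm a b q c n -
        (1 - a * c) * (1 - b * c) * baileyTerm a b q (c * q ^ 2) n =
      (1 - c) * (1 - c * q) *
        ((1 - q ^ (2 * n)) / (1 - c * q ^ n) * baileyTerm a b q c n -
          (1 - q ^ (2 * (n + 1))) / (1 - c * q ^ (n + 1)) * baileyTerm a b q c (n + 1)) := by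
  have h0 : 1 - c ≠ 0 := by simpa using one_sub_mul_pow_ne_zero hc hq 0
  have h1 : 1 - c * q ≠ 0 := by simpa using one_sub_mul_pow_ne_zero hc hq 1
  have hn := one_sub_mul_pow_ne_zero hc hq n
  have hn1 : 1 - c * (q ^ n * q) ≠ 0 := by
    simpa [pow_succ] using one_sub_mul_pow_ne_zero hc hq (n + 1)
  have hP := qPoch_ne_zero hc hq n
  have hshift : qPoch (c * q ^ 2) q n =
      qPoch c q n * (1 - c * q ^ n) * (1 - c * (q ^ n * q)) / ((1 - c) * (1 - c * q)) := by
    rw [eq_div_iff (mul_ne_zero h0 h1), ← pow_succ, ← qPoch_succ, ← qPoch_succ,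
      show n + 1 + 1 = 2 + n by ring, qPoch_add c q 2 n]
    simp [qPoch, Finset.prod_range_succ]
    ring
  have hrec : (1 - q ^ (2 * (n + 1))) / (1 - c * q ^ (n + 1)) * baileyTerm a b q c (n + 1) =
      (1 - a * q ^ n) * (1 - b * q ^ n) * q ^ n * baileyCoeff a b q n * c ^ (n + 1) /
        ((1 - c * (q ^ n * q)) * (qPoch c q n * (1 - c * q ^ n))) := by
    rw [← baileyCoeff_succ a b hq n, baileyTerm, qPoch_succ, div_mul_div_comm, pow_succ q n]
    congr 1
    ring
  have hq2n : q ^ (2 * n) = (q ^ n) ^ 2 := by ring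
  rw [hrec, baileyTerm, baileyTerm, hshift, hq2n, mul_pow, ← pow_mul, hq2n]
  -- What is left is a rational identity in `x = q ^ n` and `c`, which uses `a * b = q`.
  generalize q ^ n = x at *
  generalize baileyCoeff a b q n = u
  generalize qPoch c q n = P at *
  rw [pow_succ c n]
  generalize c ^ n = y
  have hn2 : 1 - c * q * x ≠ 0 := by rwa [mul_assoc, mul_comm q]
  field_simp
  subst hab
  ring

theorem tsum_baileyTerm_functional {a b q c : ℂ} (hab : a * b = q) (hq : ‖q‖ < 1)
    (hc : ‖c‖ < 1) :
    (1 - c) * (1 - c * q) * ∑' n, baileyTerm a b q c n =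
      (1 - a * c) * (1 - b * c) * ∑' n, baileyTerm a b q (c * q ^ 2) n := by
  have hs := summable_baileyTerm a b hq hc
  have hs2 := summable_baileyTerm a b hq (norm_mul_pow_lt_one hq hc 2)
  have hD := ((hs.hasSum.mul_left ((1 - c) * (1 - c * q))).sub
    (hs2.hasSum.mul_left ((1 - a * c) * (1 - b * c)))).tendsto_sum_nat
  simp only [baileyTerm_telescope hab hq hc, ← Finset.mul_sum, Finset.sum_range_sub'] at hD
  have hpow : Tendsto (fun n : ℕ => q ^ n) atTop (𝓝 0) :=
    tendsto_pow_atTop_nhds_zero_of_norm_lt_one hq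
  have hG : Tendsto (fun n => (1 - q ^ (2 * n)) / (1 - c * q ^ n) * baileyTerm a b q c n)
      atTop (𝓝 0) := by
    have h := (((hpow.pow 2).const_sub 1).div ((hpow.const_mul c).const_sub 1)
      (by simp)).mul hs.tendsto_atTop_zero
    simpa [← pow_mul, mul_comm 2] using h
  have h0 := tendsto_nhds_unique hD ((hG.const_sub _).const_mul ((1 - c) * (1 - c * q)))
  simpa [sub_eq_zero] using h0

theorem tsum_baileyTerm_iterate {a b q c : ℂ} (hab : a * b = q) (hq : ‖q‖ < 1)
    (hc : ‖c‖ < 1) (m : ℕ) :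
    ∑' n, baileyTerm a b q c n =
      qPoch (a * c) (q ^ 2) m * qPoch (b * c) (q ^ 2) m / qPoch c q (2 * m) *
        ∑' n, baileyTerm a b q (c * q ^ (2 * m)) n := by
  induction m with
  | zero => simp [qPoch_zero]
  | succ m ih =>
    have hf := tsum_baileyTerm_functional hab hq (norm_mul_pow_lt_one hq hc (2 * m))
    have h1 := one_sub_mul_pow_ne_zero hc hq (2 * m)
    have h2 := one_sub_mul_pow_ne_zero hc hq (2 * m + 1)
    have hP := qPoch_ne_zero hc hq (2 * m)
    rw [ih, show 2 * (m + 1) = 2 * m + 1 + 1 by ring]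
    simp only [qPoch_succ, ← pow_mul]
    rw [mul_assoc c _ q, ← pow_succ, mul_assoc c _ (q ^ 2), ← pow_add] at hf
    rw [show 2 * m + 1 + 1 = 2 * m + 2 by ring, div_mul_eq_mul_div, div_mul_eq_mul_div,
      div_eq_div_iff hP (mul_ne_zero (mul_ne_zero hP h1) h2)]
    linear_combination qPoch (a * c) (q ^ 2) m * qPoch (b * c) (q ^ 2) m *
      qPoch c q (2 * m) * hf

theorem tendsto_tsum_baileyTerm_shift {q c : ℂ} (a b : ℂ) (hq : ‖q‖ < 1) (hc : ‖c‖ < 1) :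
    Tendsto (fun m : ℕ => ∑' n, baileyTerm a b q (c * q ^ (2 * m)) n) atTop (𝓝 1) := by
  obtain ⟨K, hK⟩ := exists_norm_baileyTerm_le a b hq hc
  have hK0 : 0 ≤ K := by simpa using (norm_nonneg _).trans (hK 0 0)
  have h2 : Tendsto (fun m : ℕ => 2 * m) atTop atTop :=
    tendsto_id.const_mul_atTop' two_pos
  have hcq : Tendsto (fun m : ℕ => ‖c * q ^ (2 * m)‖) atTop (𝓝 0) := by
    simpa using (((tendsto_pow_atTop_nhds_zero_of_norm_lt_one hq).comp h2).const_mul c).norm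
  have h1 : ∑' n : ℕ, (if n = 0 then (1 : ℂ) else 0) = 1 := tsum_ite_eq 0 _
  rw [← h1]
  refine tendsto_tsum_of_dominated_convergence
    ((summable_geometric_of_lt_one (norm_nonneg c) hc).mul_left K) (fun n => ?_)
    (Eventually.of_forall fun m n => (hK _ n).trans ?_)
  · rcases eq_or_ne n 0 with rfl | hn
    · simp [baileyTerm, baileyCoeff, qPoch_zero]
    · rw [if_neg hn]
      refine squeeze_zero_norm (fun m => hK (2 * m) n) ?_
      simpa [hn] using (hcq.pow n).const_mul K
  · gcongr
    rw [norm_mul, norm_pow]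
    exact mul_le_of_le_one_right (norm_nonneg _) (pow_le_one₀ (norm_nonneg _) hq.le)

/-- Andrews' `q`-analogue of Bailey's theorem.  The hypothesis `a * b = q` replaces the usual
parameters `b`, `q / b`, so that nothing has to be nonzero. -/
theorem hasSum_baileyTerm {a b q c : ℂ} (hab : a * b = q) (hq : ‖q‖ < 1) (hc : ‖c‖ < 1) :
    HasSum (baileyTerm a b q c)
      (qPochInf (a * c) (q ^ 2) * qPochInf (b * c) (q ^ 2) / qPochInf c q) := by
  have hq2 := norm_sq_lt_one hq
  have h2 : Tendsto (fun m : ℕ => 2 * m) atTop atTop :=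
    tendsto_id.const_mul_atTop' two_pos
  have h := (((tendsto_qPoch (a * c) hq2).mul (tendsto_qPoch (b * c) hq2)).div
    ((tendsto_qPoch c hq).comp h2) (qPochInf_ne_zero hc hq)).mul
      (tendsto_tsum_baileyTerm_shift a b hq hc)
  rw [mul_one] at h
  rw [← tendsto_nhds_unique (tendsto_const_nhds.congr (tsum_baileyTerm_iterate hab hq hc)) h]
  exact (summable_baileyTerm a b hq hc).hasSum

/-! ### Specialization to base `q ^ 4` -/

theorem mainTheorem2 (q : ℂ) (hq : ‖q‖ < 1) :
    HasSum
      (fun n : ℕ =>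
        qPoch q (q ^ 2) (2 * n) * q ^ (2 * n ^ 2) * (-1) ^ n /
          (qPoch (q ^ 8) (q ^ 8) n * qPoch (-q ^ 2) (q ^ 4) n))
      (qPochInf (-q ^ 3) (q ^ 8) * qPochInf (-q ^ 5) (q ^ 8) * qPochInf (q ^ 8) (q ^ 8) *
        (qPochInf (q ^ 2) (q ^ 4) / qPochInf (q ^ 4) (q ^ 4))) := by
  have hq2 := norm_sq_lt_one hq
  have hq4 : ‖q ^ 4‖ < 1 := by simpa [← pow_mul] using norm_sq_lt_one hq2
  have hc : ‖-q ^ 2‖ < 1 := by rwa [norm_neg]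
  have e8 : (q ^ 4) ^ 2 = q ^ 8 := by ring
  have hexp : ∀ n : ℕ, 2 * n ^ 2 = 4 * n.choose 2 + 2 * n := fun n => by
    induction n with
    | zero => rfl
    | succ n ih =>
      rw [Nat.choose_succ_succ' n 1, Nat.choose_one_right]
      linarith
  have h := hasSum_baileyTerm (a := q ^ 3) (b := q) (by ring) hq4 hc
  convert h using 1
  · funext n
    have hsplit := qPoch_two_mul q (q ^ 2) n
    rw [show (q ^ 2) ^ 2 = q ^ 4 by ring, show q * q ^ 2 = q ^ 3 by ring] at hsplit
    rw [baileyTerm, baileyCoeff, hsplit, e8, hexp n, neg_pow (q ^ 2) n, pow_add, pow_mul, pow_mul]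
    ring
  · have hsq := qPochInf_mul_qPochInf_neg (q ^ 2) hq4
    have hpar := qPochInf_eq_mul (q ^ 4) hq4
    rw [show (q ^ 2) ^ 2 = q ^ 4 by ring, e8] at hsq
    rw [show q ^ 4 * q ^ 4 = q ^ 8 by ring, e8] at hpar
    rw [e8, show q ^ 3 * -q ^ 2 = -q ^ 5 by ring, show q * -q ^ 2 = -q ^ 3 by ring,
      eq_div_iff (qPochInf_ne_zero hc hq4)]
    have hne := qPochInf_ne_zero hq4 hq4
    field_simp
    rw [hpar, ← hsq]
    ring
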